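/- Let $(\mathcal W,\otimes,I)$ be a monoidal category (coherence isomorphisms are suppressed below; in particular $\mathcal W$ may be strict) such that: $\mathcal W$ is locally finitely presentable; $I$ is finitely presentable and $A\otimes B$ is finitely presentable whenever $A$ and $B$ are; for every object $Y$ the functor $-\otimes Y$ preserves finite coproducts; and $\otimes$ preserves filtered colimits in each variable. Let $H$ be a finitary endofunctor of $\mathcal W$, i.e. one that preserves filtered colimits. A *point-strength* of an endofunctor $F$ of $\mathcal W$ is a family of morphisms $s_{(X,x),(Y,y)}\colon FX\otimes Y\to F(X\otimes Y)$, natural in the pointed objects $(X,x\colon I\to X)$ and $(Y,y\colon I\to Y)$ ranging through the slice category $I/\mathcal W$, such that $s_{(X,x),(I,\mathrm{id})}=\mathrm{id}_{FX}$ and $s_{(X,x),(Y\otimes Z,\,y\otimes z)}=s_{(X\otimes Y,\,x\otimes y),(Z,z)}\cdot(s_{(X,x),(Y,y)}\otimes Z)$. A monad $(M,\eta,\mu)$ on $\mathcal W$ is *point-strong* with a point-strength $s$ of $M$ if moreover $s_{(X,x),(Y,y)}\cdot(\eta_X\otimes Y)=\eta_{X\otimes Y}$ and $s_{(X,x),(Y,y)}\cdot(\mu_X\otimes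 Y)=\mu_{X\otimes Y}\cdot Ms_{(X,x),(Y,y)}\cdot s_{(MX,\,\eta_X\cdot x),(Y,y)}$. An $H$-algebra $a\colon HA\to A$ is *completely iterative* (a cia) if for every object $X$ and every morphism $e\colon X\to HX+A$ there is a unique *solution*, i.e. a unique $e^\dagger\colon X\to A$ with $e^\dagger=[a,\mathrm{id}_A]\cdot(He^\dagger+\mathrm{id}_A)\cdot e$. For every object $X$ let $\tau_X\colon HTX\to TX$ be a free cia on $X$ with universal arrow $\eta^T_X\colon X\to TX$; then $[\tau_X,\eta^T_X]\colon HTX+X\to TX$ is an isomorphism. The free completely iterative monad $\mathbb T=(T,\eta^T,\mu^T)$ of $H$ is the monad formed by these free cias: $Tg$, for $g\colon X\to X'$, is the unique homomorphism with $Tg\cdot\eta^T_X=\eta^T_{X'}\cdot g$, and $\mu^T_X\colon TTX\to TX$ is the unique homomorphism with $\mu^T_X\cdot\eta^T_{TX}=\mathrm{id}_{TX}$. **Theorem.** Suppose that $H$ has a point-strength $s^H$. Then the monad $\mathbb T$ is point-strong, with a strength $s^T$ whose components $s^T_{(X,x),(Y,y)}\colon TX\otimes Y\to T(X\otimes Y)$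 have the following two properties for all pointed objects $(X,x)$ and $(Y,y)$. 1. $s^T_{(X,x),(Y,y)}$ is the unique solution, in the cia $T(X\otimes Y)$, of the equation morphism $$TX\otimes Y\xrightarrow{\;[\tau_X,\eta^T_X]^{-1}\otimes Y\;}HTX\otimes Y+X\otimes Y\xrightarrow{\;s^H_{(TX,\,\eta^T_X\cdot x),(Y,y)}+\eta^T_{X\otimes Y}\;}H(TX\otimes Y)+T(X\otimes Y).$$ 2. $s^T_{(X,x),(Y,y)}$ is the unique morphism $s\colon TX\otimes Y\to T(X\otimes Y)$ with $$s\cdot(\tau_X\otimes Y)=\tau_{X\otimes Y}\cdot Hs\cdot s^H_{(TX,\,\eta^T_X\cdot x),(Y,y)}\qquad\text{and}\qquad s\cdot(\eta^T_X\otimes Y)=\eta^T_{X\otimes Y}.$$ -/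

import Mathlib

open CategoryTheory Limits MonoidalCategory

universe v u

/-- Monoidally locally finitely presentable categories. The coherence isomorphisms of the monoidal
structure are not required to be identities, so strict monoidal categories are a special case. -/
class MonoidallyLFP (W : Type u) [Category.{v} W] [MonoidalCategory W] : Prop where
  /-- `W` is locally finitely presentable. -/
  lfp : IsLocallyFinitelyPresentable.{v} W
  /-- The tensor unit is finitely presentable. -/
  unit_fp : IsFinitelyPresentable.{v} (𝟙_ W)
  /-- The tensor product of finitely presentable objects is finitely presentable. -/
  tensor_fp : ∀ A B : W, IsFinitelyPresentable.{v} A → IsFinitelyPresentable.{v} B →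
    IsFinitelyPresentable.{v} (A ⊗ B)
  /-- Right distributivity: every functor `- ⊗ Y` preserves finite coproducts. -/
  right_distrib : ∀ Y : W, PreservesFiniteCoproducts (tensorRight Y)
  /-- The tensor product preserves filtered colimits in its first variable. -/
  tensorRight_finitary : ∀ Y : W, PreservesFilteredColimits (tensorRight Y)
  /-- The tensor product preserves filtered colimits in its second variable. -/
  tensorLeft_finitary : ∀ X : W, PreservesFilteredColimits (tensorLeft X)

namespace MonoidallyLFP

variable (W : Type u) [Category.{v} W] [MonoidalCategory W] [MonoidallyLFP W]

instance : HasColimits W :=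
  (MonoidallyLFP.lfp (W := W)).toHasColimitsOfSize

instance (Y : W) : PreservesFiniteCoproducts (tensorRight Y) :=
  MonoidallyLFP.right_distrib Y

end MonoidallyLFP

section Strength

variable {W : Type u} [Category.{v} W] [MonoidalCategory W]

/-- The point `I ≅ I ⊗ I ⟶ X ⊗ Y` of the tensor product of two pointed objects. -/
def tensorPoint {X Y : W} (x : 𝟙_ W ⟶ X) (y : 𝟙_ W ⟶ Y) : 𝟙_ W ⟶ X ⊗ Y :=
  (λ_ (𝟙_ W)).inv ≫ (x ⊗ₘ y)

/-- A point-strength of an endofunctor `H`: morphisms `H X ⊗ Y ⟶ H (X ⊗ Y)` for all pointed objects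
`(X, x)` and `(Y, y)`, that is, objects of the slice category under the tensor unit. A morphism
of pointed objects with domain `(X, x)` is a morphism `f : X ⟶ X'`, its codomain being
`(X', x ≫ f)`; `naturality` is naturality with respect to these. -/
structure PointStrength (H : W ⥤ W) where
  /-- the component at the pointed objects `(X, x)` and `(Y, y)` -/
  app : ∀ {X Y : W} (_ : 𝟙_ W ⟶ X) (_ : 𝟙_ W ⟶ Y), H.obj X ⊗ Y ⟶ H.obj (X ⊗ Y)
  naturality : ∀ {X X' Y Y' : W} (x : 𝟙_ W ⟶ X) (y : 𝟙_ W ⟶ Y) (f : X ⟶ X') (g : Y ⟶ Y'),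
    (H.map f ⊗ₘ g) ≫ app (x ≫ f) (y ≫ g) = app x y ≫ H.map (f ⊗ₘ g)
  unit : ∀ {X : W} (x : 𝟙_ W ⟶ X),
    app x (𝟙 (𝟙_ W)) ≫ H.map (ρ_ X).hom = (ρ_ (H.obj X)).hom
  assoc : ∀ {X Y Z : W} (x : 𝟙_ W ⟶ X) (y : 𝟙_ W ⟶ Y) (z : 𝟙_ W ⟶ Z),
    app x y ▷ Z ≫ app (tensorPoint x y) z ≫ H.map (α_ X Y Z).hom =
      (α_ (H.obj X) Y Z).hom ≫ app x (tensorPoint y z)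

/-- A point-strength of a monad: a point-strength of the underlying endofunctor that preserves the
unit and the multiplication of the monad. -/
structure MonadPointStrength (M : Monad W) extends PointStrength M.toFunctor where
  preserves_unit : ∀ {X Y : W} (x : 𝟙_ W ⟶ X) (y : 𝟙_ W ⟶ Y),
    M.η.app X ▷ Y ≫ app x y = M.η.app (X ⊗ Y)
  preserves_mul : ∀ {X Y : W} (x : 𝟙_ W ⟶ X) (y : 𝟙_ W ⟶ Y),
    app (X := M.obj X) (x ≫ M.η.app X) y ≫ M.map (app x y) ≫ M.μ.app (X ⊗ Y) =
      M.μ.app X ▷ Y ≫ app x y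

end Strength

section Cia

variable {W : Type u} [Category.{v} W] [HasBinaryCoproducts W] {H : W ⥤ W}

/-- `s` is a solution in the algebra `A` of the flat equation morphism `e`. -/
def IsSolution (A : Endofunctor.Algebra H) {X : W} (e : X ⟶ H.obj X ⨿ A.a) (s : X ⟶ A.a) : Prop :=
  s = e ≫ coprod.map (H.map s) (𝟙 A.a) ≫ coprod.desc A.str (𝟙 A.a)

/-- Completely iterative algebras: every flat equation morphism has a unique solution. -/
def IsCia (A : Endofunctor.Algebra H) : Prop :=
  ∀ (X : W) (e : X ⟶ H.obj X ⨿ A.a), ∃! s : X ⟶ A.a, IsSolution A e s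

variable (H) in
/-- A free completely iterative algebra for `H` on the object `X`: a completely iterative algebra
with a universal arrow `unit : X ⟶ alg.a`. Morphisms are all homomorphisms of algebras. -/
structure FreeCia (X : W) where
  /-- the algebra -/
  alg : Endofunctor.Algebra H
  isCia : IsCia alg
  /-- the universal arrow -/
  unit : X ⟶ alg.a
  existsUnique_hom : ∀ (B : Endofunctor.Algebra H), IsCia B → ∀ f : X ⟶ B.a,
    ∃! h : alg ⟶ B, unit ≫ h.f = f

namespace FreeCia

/-- The unique homomorphism from a free cia to a cia that extends a given morphism. -/
noncomputable def lift {X : W} (T : FreeCia H X) (B : Endofunctor.Algebra H) (hB : IsCia B)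
    (f : X ⟶ B.a) : T.alg ⟶ B :=
  (T.existsUnique_hom B hB f).choose

theorem unit_lift {X : W} (T : FreeCia H X) (B : Endofunctor.Algebra H) (hB : IsCia B)
    (f : X ⟶ B.a) : T.unit ≫ (T.lift B hB f).f = f :=
  (T.existsUnique_hom B hB f).choose_spec.1

theorem hom_ext {X : W} (T : FreeCia H X) (B : Endofunctor.Algebra H) (hB : IsCia B)
    {h k : T.alg ⟶ B} (w : T.unit ≫ h.f = T.unit ≫ k.f) : h = k :=
  (T.existsUnique_hom B hB (T.unit ≫ k.f)).unique w rfl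

/-- The morphism `[τ, η] : H (T X) + X ⟶ T X`. -/
noncomputable def struc {X : W} (T : FreeCia H X) : H.obj T.alg.a ⨿ X ⟶ T.alg.a :=
  coprod.desc T.alg.str T.unit

/-- The algebra on `H (T X) + X` transported along `[τ, η]`. -/
noncomputable abbrev sumAlg {X : W} (T : FreeCia H X) : Endofunctor.Algebra H where
  a := H.obj T.alg.a ⨿ X
  str := H.map T.struc ≫ coprod.inl

theorem sumAlg_isCia {X : W} (T : FreeCia H X) : IsCia T.sumAlg := by
  intro Z e
  change Z ⟶ H.obj Z ⨿ (H.obj T.alg.a ⨿ X) at e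
  change ∃! r : Z ⟶ H.obj T.alg.a ⨿ X,
    r = e ≫ coprod.map (H.map r) (𝟙 _) ≫ coprod.desc (H.map T.struc ≫ coprod.inl) (𝟙 _)
  obtain ⟨s, hs, hu⟩ := T.isCia Z (e ≫ coprod.map (𝟙 _) T.struc)
  have hs' : s = e ≫ coprod.desc (H.map s ≫ T.alg.str) T.struc := by
    simpa [IsSolution] using hs
  have hu' : ∀ r, r = e ≫ coprod.desc (H.map r ≫ T.alg.str) T.struc → r = s := by
    intro r hr
    exact hu r (by simpa [IsSolution] using hr)
  have hd : ∀ t : Z ⟶ T.alg.a,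
      coprod.desc (H.map t ≫ coprod.inl) (𝟙 (H.obj T.alg.a ⨿ X)) ≫ T.struc =
        coprod.desc (H.map t ≫ T.alg.str) T.struc := by
    intro t
    rw [coprod.desc_comp, Category.assoc, struc, coprod.inl_desc, Category.id_comp]
  have hm : ∀ r : Z ⟶ H.obj T.alg.a ⨿ X,
      coprod.map (H.map r) (𝟙 _) ≫ coprod.desc (H.map T.struc ≫ coprod.inl) (𝟙 _) =
        coprod.desc (H.map (r ≫ T.struc) ≫ coprod.inl) (𝟙 (H.obj T.alg.a ⨿ X)) := by
    intro r
    rw [coprod.map_desc, Category.comp_id, H.map_comp, Category.assoc]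
  simp only [hm]
  have h2 : (e ≫ coprod.desc (H.map s ≫ coprod.inl) (𝟙 (H.obj T.alg.a ⨿ X))) ≫ T.struc = s := by
    rw [Category.assoc, hd, ← hs']
  refine ⟨e ≫ coprod.desc (H.map s ≫ coprod.inl) (𝟙 (H.obj T.alg.a ⨿ X)), ?_, ?_⟩
  · change _ = _
    rw [h2]
  · intro r hr
    change r = _ at hr
    have h3 : r ≫ T.struc = s := by
      apply hu'
      conv_lhs => rw [hr]
      rw [Category.assoc, hd]
    rw [h3] at hr
    exact hr

/-- The morphism `[τ, η]` of a free cia is an isomorphism. -/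
instance isIso_struc {X : W} (T : FreeCia H X) : IsIso T.struc := by
  obtain ⟨⟨i, hi⟩, hu, -⟩ := T.existsUnique_hom T.sumAlg T.sumAlg_isCia coprod.inr
  change T.alg.a ⟶ H.obj T.alg.a ⨿ X at i
  change H.map i ≫ H.map T.struc ≫ coprod.inl = T.alg.str ≫ i at hi
  change T.unit ≫ i = coprod.inr at hu
  have hij : i ≫ T.struc = 𝟙 T.alg.a := by
    have h := T.hom_ext T.alg T.isCia
      (h := { f := i ≫ T.struc
              h := by
                rw [← Category.assoc, ← hi, H.map_comp, Category.assoc, Category.assoc,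
                  Category.assoc, struc, coprod.inl_desc] })
      (k := 𝟙 T.alg) (by
        change T.unit ≫ i ≫ T.struc = T.unit ≫ 𝟙 _
        rw [← Category.assoc, hu, struc, coprod.inr_desc, Category.comp_id])
    exact congrArg Endofunctor.Algebra.Hom.f h
  refine ⟨i, ?_, hij⟩
  rw [struc, coprod.desc_comp, hu, ← hi, ← Category.assoc, ← H.map_comp, hij, H.map_id,
    Category.id_comp]
  exact coprod.desc_inl_inr

end FreeCia

/-- The free completely iterative monad `(T, η, μ)` of `H`, formed by free cias on all objects:
`η` consists of the universal arrows, `T g` is the homomorphism extending `g ≫ η`, and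
`μ` at `X` is the homomorphism `T (T X) ⟶ T X` extending the identity of `T X`. -/
noncomputable abbrev freeCiaMonad (T : ∀ X : W, FreeCia H X) : Monad W where
  obj X := (T X).alg.a
  map {X Y} g := ((T X).lift (T Y).alg (T Y).isCia (g ≫ (T Y).unit)).f
  map_id X := by
    rw [← Endofunctor.Algebra.id_f]
    congr 1
    apply FreeCia.hom_ext _ _ (T X).isCia
    rw [FreeCia.unit_lift, Endofunctor.Algebra.id_f, Category.id_comp, Category.comp_id]
  map_comp {X Y Z} f g := by
    rw [← Endofunctor.Algebra.comp_f]
    congr 1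
    apply FreeCia.hom_ext _ _ (T Z).isCia
    rw [FreeCia.unit_lift, Endofunctor.Algebra.comp_f, ← Category.assoc, FreeCia.unit_lift,
      Category.assoc, Category.assoc, FreeCia.unit_lift]
  η := { app := fun X => (T X).unit
         naturality := fun X Y g => (FreeCia.unit_lift _ _ _ _).symm }
  μ := { app := fun X => ((T (T X).alg.a).lift (T X).alg (T X).isCia (𝟙 _)).f
         naturality := fun X Y g => by
           dsimp
           rw [← Endofunctor.Algebra.comp_f, ← Endofunctor.Algebra.comp_f]
           congr 1
           apply FreeCia.hom_ext _ _ (T Y).isCia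
           simp only [Endofunctor.Algebra.comp_f]
           rw [← Category.assoc, FreeCia.unit_lift, Category.assoc, FreeCia.unit_lift,
             ← Category.assoc, FreeCia.unit_lift, Category.comp_id, Category.id_comp] }
  assoc X := by
    dsimp
    rw [← Endofunctor.Algebra.comp_f, ← Endofunctor.Algebra.comp_f]
    congr 1
    apply FreeCia.hom_ext _ _ (T X).isCia
    simp only [Endofunctor.Algebra.comp_f]
    rw [← Category.assoc, FreeCia.unit_lift, Category.assoc, FreeCia.unit_lift,
      ← Category.assoc, FreeCia.unit_lift, Category.comp_id, Category.id_comp]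
  left_unit X := FreeCia.unit_lift _ _ _ _
  right_unit X := by
    dsimp
    rw [← Endofunctor.Algebra.comp_f, ← Endofunctor.Algebra.id_f]
    congr 1
    apply FreeCia.hom_ext _ _ (T X).isCia
    simp only [Endofunctor.Algebra.comp_f, Endofunctor.Algebra.id_f]
    rw [← Category.assoc, FreeCia.unit_lift, Category.assoc, FreeCia.unit_lift]

end Cia

section Equation

variable {W : Type u} [Category.{v} W] [MonoidalCategory W] [MonoidallyLFP W] {H : W ⥤ W}

/-- For pointed objects `(X, x)` and `(Y, y)`, the flat equation morphism in the cia `T (X ⊗ Y)`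
`T X ⊗ Y ≅ (H (T X) + X) ⊗ Y ≅ H (T X) ⊗ Y + X ⊗ Y ⟶ H (T X ⊗ Y) + T (X ⊗ Y)`,
given by the inverse of `[τ, η]`, by right distributivity, and by the sum of the point-strength of
`H` (where `T X` is pointed by `x ≫ η`) and of `η`. -/
noncomputable def strengthEquation (sH : PointStrength H) (T : ∀ X : W, FreeCia H X)
    {X Y : W} (x : 𝟙_ W ⟶ X) (y : 𝟙_ W ⟶ Y) :
    (T X).alg.a ⊗ Y ⟶ H.obj ((T X).alg.a ⊗ Y) ⨿ (T (X ⊗ Y)).alg.a :=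
  inv (T X).struc ▷ Y ≫
    inv (coprodComparison (tensorRight Y) (H.obj (T X).alg.a) X) ≫
      coprod.map (sH.app (x ≫ (T X).unit) y) (T (X ⊗ Y)).unit

/-- The diagram relating a morphism `s : T X ⊗ Y ⟶ T (X ⊗ Y)` to the point-strength of `H`:
`s` is compatible with the algebra structures `τ` and with the universal arrows `η`. -/
def IsStrengthComponent (sH : PointStrength H) (T : ∀ X : W, FreeCia H X)
    {X Y : W} (x : 𝟙_ W ⟶ X) (y : 𝟙_ W ⟶ Y) (s : (T X).alg.a ⊗ Y ⟶ (T (X ⊗ Y)).alg.a) : Prop :=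
  (T X).alg.str ▷ Y ≫ s =
      sH.app (x ≫ (T X).unit) y ≫ H.map s ≫ (T (X ⊗ Y)).alg.str ∧
    (T X).unit ▷ Y ≫ s = (T (X ⊗ Y)).unit

end Equation

section PointStrengthOfFreeCia

variable {W : Type u} [Category.{v} W] [MonoidalCategory W]

/-! Since `[τ, η]` is invertible and `- ⊗ Y` preserves binary coproducts, `T X ⊗ Y` is the coproduct
of `H (T X) ⊗ Y` and `X ⊗ Y`. Any `p : H (T X) ⊗ Y ⟶ H (T X ⊗ Y)` and `q : X ⊗ Y ⟶ B` therefore form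
a flat equation on `T X ⊗ Y`. Its solutions in an algebra `B` are exactly the `s` with `(τ ⊗ Y) ≫ s
= p ≫ H s ≫ b`, where `b` is the structure of `B`, and `(η ⊗ Y) ≫ s = q`
(`isSolution_tensorEquation_iff`). If `B` is a cia, there is exactly one such `s`.

Existence, with `p` the strength of `H` and `q = η`, defines the strength of `T`, and the
equivalence makes the two characterizations one. Uniqueness (`tensor_hom_ext`) proves the axioms:
both sides of each identity solve the same equation. Each axiom of the strength of `T` as an
endofunctor uses its counterpart for `H`; compatibility with `μ` uses naturality of the strength of
`H`. -/

theorem tensorPoint_comp_tensorHom {X X' Y Y' : W} (x : 𝟙_ W ⟶ X) (y : 𝟙_ W ⟶ Y) (f : X ⟶ X')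
    (g : Y ⟶ Y') : tensorPoint x y ≫ (f ⊗ₘ g) = tensorPoint (x ≫ f) (y ≫ g) := by
  simp [tensorPoint]

/-- The target point `x'` is a separate variable because in the applications it equals `x ≫ f` only
by a proved equation, not definitionally. -/
theorem PointStrength.whiskerRight_app {H : W ⥤ W} (s : PointStrength H) {X X' Y : W}
    (x : 𝟙_ W ⟶ X) (x' : 𝟙_ W ⟶ X') (y : 𝟙_ W ⟶ Y) (f : X ⟶ X') (hx : x ≫ f = x') :
    H.map f ▷ Y ≫ s.app x' y = s.app x y ≫ H.map (f ▷ Y) := by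
  subst hx
  simpa using s.naturality x y f (𝟙 Y)

variable [MonoidallyLFP W] {H : W ⥤ W}

/-! ### Recursion on `T X ⊗ Y` with values in a cia -/

namespace FreeCia

/-- The canonical morphism from the coproduct of tensor products, `coprodComparison (tensorRight Y)`
stated in terms of whiskerings. -/
noncomputable abbrev tensorCoprodComparison (A B Y : W) : (A ⊗ Y) ⨿ (B ⊗ Y) ⟶ (A ⨿ B) ⊗ Y :=
  coprod.desc (coprod.inl ▷ Y) (coprod.inr ▷ Y)

instance (A B Y : W) : IsIso (tensorCoprodComparison A B Y) :=
  inferInstanceAs (IsIso (coprodComparison (tensorRight Y) A B))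

/-- A flat equation morphism on `T X ⊗ Y` with values in an algebra `B`, obtained from
`[τ, η]⁻¹ ⊗ Y`, right distributivity and a pair of morphisms. -/
noncomputable def tensorEquation {X : W} (T : FreeCia H X) (Y : W) {B : W}
    (p : H.obj T.alg.a ⊗ Y ⟶ H.obj (T.alg.a ⊗ Y)) (q : X ⊗ Y ⟶ B) :
    T.alg.a ⊗ Y ⟶ H.obj (T.alg.a ⊗ Y) ⨿ B :=
  inv T.struc ▷ Y ≫ inv (tensorCoprodComparison (H.obj T.alg.a) X Y) ≫ coprod.map p q

theorem tensorCoprodComparison_struc {X : W} (T : FreeCia H X) (Y : W) :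
    tensorCoprodComparison (H.obj T.alg.a) X Y ≫ T.struc ▷ Y =
      coprod.desc (T.alg.str ▷ Y) (T.unit ▷ Y) := by
  rw [coprod.desc_comp, ← comp_whiskerRight, ← comp_whiskerRight, struc, coprod.inl_desc,
    coprod.inr_desc]

/-- Cancelling the two isomorphisms leaves an equation between morphisms out of a coproduct; its two
components are the two conditions. -/
theorem isSolution_tensorEquation_iff {X : W} (T : FreeCia H X) {Y : W} (B : Endofunctor.Algebra H)
    (p : H.obj T.alg.a ⊗ Y ⟶ H.obj (T.alg.a ⊗ Y)) (q : X ⊗ Y ⟶ B.a) (s : T.alg.a ⊗ Y ⟶ B.a) :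
    IsSolution B (T.tensorEquation Y p q) s ↔
      T.alg.str ▷ Y ≫ s = p ≫ H.map s ≫ B.str ∧ T.unit ▷ Y ≫ s = q := by
  have hs : T.tensorEquation Y p q ≫ coprod.map (H.map s) (𝟙 B.a) ≫ coprod.desc B.str (𝟙 B.a) =
      inv (T.struc ▷ Y) ≫ inv (tensorCoprodComparison (H.obj T.alg.a) X Y) ≫
        coprod.desc (p ≫ H.map s ≫ B.str) q := by
    rw [tensorEquation, inv_whiskerRight, Category.assoc, Category.assoc, coprod.map_desc,
      coprod.map_desc, Category.comp_id, Category.comp_id]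
  rw [IsSolution, hs, IsIso.eq_inv_comp, IsIso.eq_inv_comp, ← Category.assoc,
    tensorCoprodComparison_struc, coprod.desc_comp]
  constructor
  · intro h
    exact ⟨by simpa only [coprod.inl_desc] using coprod.inl ≫= h,
      by simpa only [coprod.inr_desc] using coprod.inr ≫= h⟩
  · rintro ⟨h₁, h₂⟩
    rw [h₁, h₂]

theorem existsUnique_tensor {X : W} (T : FreeCia H X) {Y : W} {B : Endofunctor.Algebra H}
    (hB : IsCia B) (p : H.obj T.alg.a ⊗ Y ⟶ H.obj (T.alg.a ⊗ Y)) (q : X ⊗ Y ⟶ B.a) :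
    ∃! s : T.alg.a ⊗ Y ⟶ B.a,
      T.alg.str ▷ Y ≫ s = p ≫ H.map s ≫ B.str ∧ T.unit ▷ Y ≫ s = q := by
  simpa only [isSolution_tensorEquation_iff] using hB _ (T.tensorEquation Y p q)

/-- Two morphisms `T X ⊗ Y ⟶ B` into a cia agree if they satisfy the same recursive equation. -/
theorem tensor_hom_ext {X : W} (T : FreeCia H X) {Y : W} {B : Endofunctor.Algebra H}
    (hB : IsCia B) (p : H.obj T.alg.a ⊗ Y ⟶ H.obj (T.alg.a ⊗ Y)) {s t : T.alg.a ⊗ Y ⟶ B.a}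
    (hs : T.alg.str ▷ Y ≫ s = p ≫ H.map s ≫ B.str) (ht : T.alg.str ▷ Y ≫ t = p ≫ H.map t ≫ B.str)
    (h : T.unit ▷ Y ≫ s = T.unit ▷ Y ≫ t) : s = t :=
  (T.existsUnique_tensor hB p (T.unit ▷ Y ≫ t)).unique ⟨hs, h⟩ ⟨ht, rfl⟩

end FreeCia

/-! ### The strength of `T` and its defining equations -/

section

variable (sH : PointStrength H) (T : ∀ X : W, FreeCia H X)

theorem isSolution_strengthEquation_iff {X Y : W} (x : 𝟙_ W ⟶ X) (y : 𝟙_ W ⟶ Y)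
    (s : (T X).alg.a ⊗ Y ⟶ (T (X ⊗ Y)).alg.a) :
    IsSolution (T (X ⊗ Y)).alg (strengthEquation sH T x y) s ↔
      IsStrengthComponent sH T x y s :=
  -- By unfolding, `strengthEquation` is the `tensorEquation` with `p` the strength of `H` and `q =
  -- η`.
  (T X).isSolution_tensorEquation_iff _ _ _ _

/-- The components of the point-strength of the free completely iterative monad. -/
noncomputable def freeCiaStrength {X Y : W} (x : 𝟙_ W ⟶ X) (y : 𝟙_ W ⟶ Y) :
    (T X).alg.a ⊗ Y ⟶ (T (X ⊗ Y)).alg.a :=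
  ((T (X ⊗ Y)).isCia _ (strengthEquation sH T x y)).choose

theorem isSolution_freeCiaStrength {X Y : W} (x : 𝟙_ W ⟶ X) (y : 𝟙_ W ⟶ Y) :
    IsSolution (T (X ⊗ Y)).alg (strengthEquation sH T x y) (freeCiaStrength sH T x y) :=
  ((T (X ⊗ Y)).isCia _ (strengthEquation sH T x y)).choose_spec.1

theorem eq_freeCiaStrength {X Y : W} (x : 𝟙_ W ⟶ X) (y : 𝟙_ W ⟶ Y)
    (s : (T X).alg.a ⊗ Y ⟶ (T (X ⊗ Y)).alg.a)
    (hs : IsSolution (T (X ⊗ Y)).alg (strengthEquation sH T x y) s) :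
    s = freeCiaStrength sH T x y :=
  ((T (X ⊗ Y)).isCia _ (strengthEquation sH T x y)).choose_spec.2 s hs

theorem str_freeCiaStrength {X Y : W} (x : 𝟙_ W ⟶ X) (y : 𝟙_ W ⟶ Y) :
    (T X).alg.str ▷ Y ≫ freeCiaStrength sH T x y =
      sH.app (x ≫ (T X).unit) y ≫ H.map (freeCiaStrength sH T x y) ≫ (T (X ⊗ Y)).alg.str :=
  ((isSolution_strengthEquation_iff sH T x y _).1 (isSolution_freeCiaStrength sH T x y)).1

theorem unit_freeCiaStrength {X Y : W} (x : 𝟙_ W ⟶ X) (y : 𝟙_ W ⟶ Y) :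
    (T X).unit ▷ Y ≫ freeCiaStrength sH T x y = (T (X ⊗ Y)).unit :=
  ((isSolution_strengthEquation_iff sH T x y _).1 (isSolution_freeCiaStrength sH T x y)).2

theorem str_freeCiaStrength_assoc {X Y Z : W} (x : 𝟙_ W ⟶ X) (y : 𝟙_ W ⟶ Y)
    (h : (T (X ⊗ Y)).alg.a ⟶ Z) :
    (T X).alg.str ▷ Y ≫ freeCiaStrength sH T x y ≫ h =
      sH.app (x ≫ (T X).unit) y ≫ H.map (freeCiaStrength sH T x y) ≫
        (T (X ⊗ Y)).alg.str ≫ h := by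
  rw [← Category.assoc, str_freeCiaStrength, Category.assoc, Category.assoc]

theorem unit_freeCiaStrength_assoc {X Y Z : W} (x : 𝟙_ W ⟶ X) (y : 𝟙_ W ⟶ Y)
    (h : (T (X ⊗ Y)).alg.a ⟶ Z) :
    (T X).unit ▷ Y ≫ freeCiaStrength sH T x y ≫ h = (T (X ⊗ Y)).unit ≫ h := by
  rw [← Category.assoc, unit_freeCiaStrength]

/-- The strength of `T` preserves points. This is what permits naturality of the strength of `H`
along it, since that naturality holds only for morphisms of pointed objects. -/
theorem tensorPoint_freeCiaStrength {X Y : W} (x : 𝟙_ W ⟶ X) (y : 𝟙_ W ⟶ Y) :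
    tensorPoint (x ≫ (T X).unit) y ≫ freeCiaStrength sH T x y =
      tensorPoint x y ≫ (T (X ⊗ Y)).unit := by
  have h := tensorPoint_comp_tensorHom x y (T X).unit (𝟙 Y)
  rw [Category.comp_id, tensorHom_id] at h
  rw [← h, Category.assoc, unit_freeCiaStrength]

/-! ### The axioms of a monad point-strength, by uniqueness of solutions -/

theorem freeCiaStrength_naturality {X X' Y Y' : W} (x : 𝟙_ W ⟶ X) (y : 𝟙_ W ⟶ Y) (f : X ⟶ X')
    (g : Y ⟶ Y') :
    ((freeCiaMonad T).map f ⊗ₘ g) ≫ freeCiaStrength sH T (x ≫ f) (y ≫ g) =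
      freeCiaStrength sH T x y ≫ (freeCiaMonad T).map (f ⊗ₘ g) := by
  let k := (T X).lift (T X').alg (T X').isCia (f ≫ (T X').unit)
  let m := (T (X ⊗ Y)).lift (T (X' ⊗ Y')).alg (T (X' ⊗ Y')).isCia ((f ⊗ₘ g) ≫ (T (X' ⊗ Y')).unit)
  have hk : (T X).unit ≫ k.f = f ≫ (T X').unit := FreeCia.unit_lift _ _ _ _
  have hm : (T (X ⊗ Y)).unit ≫ m.f = (f ⊗ₘ g) ≫ (T (X' ⊗ Y')).unit := FreeCia.unit_lift _ _ _ _
  have hkh : H.map k.f ≫ (T X').alg.str = (T X).alg.str ≫ k.f := k.h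
  have hmh : H.map m.f ≫ (T (X' ⊗ Y')).alg.str = (T (X ⊗ Y)).alg.str ≫ m.f := m.h
  change (k.f ⊗ₘ g) ≫ freeCiaStrength sH T (x ≫ f) (y ≫ g) = freeCiaStrength sH T x y ≫ m.f
  refine (T X).tensor_hom_ext (T (X' ⊗ Y')).isCia (sH.app (x ≫ (T X).unit) y) ?_ ?_ ?_
  · have h := sH.naturality (x ≫ (T X).unit) y k.f g
    -- `T f` is a morphism of pointed objects, so `h` ends in the strength at the point used for `T
    -- X'`.
    have hp : (x ≫ (T X).unit) ≫ k.f = (x ≫ f) ≫ (T X').unit := by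
      rw [Category.assoc, hk, Category.assoc]
    rw [hp] at h
    have e : (T X).alg.str ▷ Y ≫ (k.f ⊗ₘ g) = (H.map k.f ⊗ₘ g) ≫ (T X').alg.str ▷ Y' := by
      rw [← tensorHom_id, ← tensorHom_id, tensorHom_comp_tensorHom, tensorHom_comp_tensorHom,
        hkh, Category.id_comp, Category.comp_id]
    rw [← Category.assoc, e, Category.assoc, str_freeCiaStrength, ← Category.assoc, h,
      Category.assoc, H.map_comp, Category.assoc]
  · rw [str_freeCiaStrength_assoc, H.map_comp, Category.assoc, hmh]
  · have e : (T X).unit ▷ Y ≫ (k.f ⊗ₘ g) = (f ⊗ₘ g) ≫ (T X').unit ▷ Y' := by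
      rw [← tensorHom_id, ← tensorHom_id, tensorHom_comp_tensorHom, tensorHom_comp_tensorHom,
        hk, Category.id_comp, Category.comp_id]
    rw [← Category.assoc, e, Category.assoc, unit_freeCiaStrength, unit_freeCiaStrength_assoc, hm]

/-- The unit law of `H` says precisely that the right unitor satisfies the recursion of the strength
at `(I, id)`. -/
theorem freeCiaStrength_unit {X : W} (x : 𝟙_ W ⟶ X) :
    freeCiaStrength sH T x (𝟙 (𝟙_ W)) ≫ (freeCiaMonad T).map (ρ_ X).hom =
      (ρ_ (T X).alg.a).hom := by
  let m := (T (X ⊗ 𝟙_ W)).lift (T X).alg (T X).isCia ((ρ_ X).hom ≫ (T X).unit)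
  have hm : (T (X ⊗ 𝟙_ W)).unit ≫ m.f = (ρ_ X).hom ≫ (T X).unit := FreeCia.unit_lift _ _ _ _
  have hmh : H.map m.f ≫ (T X).alg.str = (T (X ⊗ 𝟙_ W)).alg.str ≫ m.f := m.h
  change freeCiaStrength sH T x (𝟙 (𝟙_ W)) ≫ m.f = _
  refine (T X).tensor_hom_ext (T X).isCia (sH.app (x ≫ (T X).unit) (𝟙 _)) ?_ ?_ ?_
  · rw [str_freeCiaStrength_assoc, H.map_comp, Category.assoc, hmh]
  · rw [← Category.assoc, sH.unit, rightUnitor_naturality]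
  · rw [unit_freeCiaStrength_assoc, hm, rightUnitor_naturality]

theorem freeCiaStrength_assoc {X Y Z : W} (x : 𝟙_ W ⟶ X) (y : 𝟙_ W ⟶ Y) (z : 𝟙_ W ⟶ Z) :
    freeCiaStrength sH T x y ▷ Z ≫ freeCiaStrength sH T (tensorPoint x y) z ≫
        (freeCiaMonad T).map (α_ X Y Z).hom =
      (α_ (T X).alg.a Y Z).hom ≫ freeCiaStrength sH T x (tensorPoint y z) := by
  let m := (T ((X ⊗ Y) ⊗ Z)).lift (T (X ⊗ Y ⊗ Z)).alg (T (X ⊗ Y ⊗ Z)).isCia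
    ((α_ X Y Z).hom ≫ (T (X ⊗ Y ⊗ Z)).unit)
  have hm : (T ((X ⊗ Y) ⊗ Z)).unit ≫ m.f = (α_ X Y Z).hom ≫ (T (X ⊗ Y ⊗ Z)).unit :=
    FreeCia.unit_lift _ _ _ _
  have hmh : H.map m.f ≫ (T (X ⊗ Y ⊗ Z)).alg.str = (T ((X ⊗ Y) ⊗ Z)).alg.str ≫ m.f := m.h
  change freeCiaStrength sH T x y ▷ Z ≫ freeCiaStrength sH T (tensorPoint x y) z ≫ m.f = _
  -- With the associator moved across, both sides start at `T X ⊗ (Y ⊗ Z)`, where uniqueness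
  -- applies; the right side satisfies the recursion by definition.
  rw [← Iso.inv_comp_eq]
  refine (T X).tensor_hom_ext (T (X ⊗ Y ⊗ Z)).isCia (sH.app (x ≫ (T X).unit) (tensorPoint y z))
    ?_ (str_freeCiaStrength sH T x _) ?_
  · have hn := sH.whiskerRight_app _ _ z _ (tensorPoint_freeCiaStrength sH T x y)
    have ha := sH.assoc (x ≫ (T X).unit) y z
    rw [← Iso.inv_comp_eq] at ha
    rw [associator_inv_naturality_left_assoc, ← comp_whiskerRight_assoc, str_freeCiaStrength,
      comp_whiskerRight, comp_whiskerRight, Category.assoc, Category.assoc,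
      str_freeCiaStrength_assoc, reassoc_of% hn, ← ha, ← hmh]
    simp only [Category.assoc, ← H.map_comp_assoc, Iso.hom_inv_id_assoc]
  · rw [associator_inv_naturality_left_assoc, ← comp_whiskerRight_assoc, unit_freeCiaStrength,
      unit_freeCiaStrength_assoc, hm, Iso.inv_hom_id_assoc, unit_freeCiaStrength]

/-- Here the recursion runs over the free cia on `T X`, with values in `T (X ⊗ Y)`; on `T X ⊗ Y`
both sides restrict to the strength itself. -/
theorem freeCiaStrength_mul {X Y : W} (x : 𝟙_ W ⟶ X) (y : 𝟙_ W ⟶ Y) :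
    freeCiaStrength sH T (x ≫ (T X).unit) y ≫
        (freeCiaMonad T).map (freeCiaStrength sH T x y) ≫ (freeCiaMonad T).μ.app (X ⊗ Y) =
      (freeCiaMonad T).μ.app X ▷ Y ≫ freeCiaStrength sH T x y := by
  let m := (T (T X).alg.a).lift (T X).alg (T X).isCia (𝟙 _)
  let n := (T (T (X ⊗ Y)).alg.a).lift (T (X ⊗ Y)).alg (T (X ⊗ Y)).isCia (𝟙 _)
  let k := (T ((T X).alg.a ⊗ Y)).lift (T (T (X ⊗ Y)).alg.a).alg (T (T (X ⊗ Y)).alg.a).isCia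
    (freeCiaStrength sH T x y ≫ (T _).unit)
  have hm : (T (T X).alg.a).unit ≫ m.f = 𝟙 _ := FreeCia.unit_lift _ _ _ _
  have hn : (T (T (X ⊗ Y)).alg.a).unit ≫ n.f = 𝟙 _ := FreeCia.unit_lift _ _ _ _
  have hk : (T ((T X).alg.a ⊗ Y)).unit ≫ k.f = freeCiaStrength sH T x y ≫ (T _).unit :=
    FreeCia.unit_lift _ _ _ _
  have hmh : H.map m.f ≫ (T X).alg.str = (T (T X).alg.a).alg.str ≫ m.f := m.h
  have hnh : H.map n.f ≫ (T (X ⊗ Y)).alg.str = (T (T (X ⊗ Y)).alg.a).alg.str ≫ n.f := n.h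
  have hkh : H.map k.f ≫ (T (T (X ⊗ Y)).alg.a).alg.str =
    (T ((T X).alg.a ⊗ Y)).alg.str ≫ k.f := k.h
  change freeCiaStrength sH T (x ≫ (T X).unit) y ≫ k.f ≫ n.f =
    m.f ▷ Y ≫ freeCiaStrength sH T x y
  refine (T (T X).alg.a).tensor_hom_ext (T (X ⊗ Y)).isCia
    (sH.app ((x ≫ (T X).unit) ≫ (T (T X).alg.a).unit) y) ?_ ?_ ?_
  · rw [str_freeCiaStrength_assoc, ← reassoc_of% hkh, ← hnh]
    simp only [H.map_comp, Category.assoc]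
  · have hx : ((x ≫ (T X).unit) ≫ (T (T X).alg.a).unit) ≫ m.f = x ≫ (T X).unit := by
      rw [Category.assoc, hm, Category.comp_id]
    have h := sH.whiskerRight_app _ _ y _ hx
    rw [← comp_whiskerRight_assoc, ← hmh, comp_whiskerRight, Category.assoc, str_freeCiaStrength,
      reassoc_of% h]
    simp only [H.map_comp, Category.assoc]
  · rw [unit_freeCiaStrength_assoc, reassoc_of% hk, hn, Category.comp_id,
      ← comp_whiskerRight_assoc, hm, id_whiskerRight, Category.id_comp]

/-- The point-strength of the free completely iterative monad. -/
noncomputable def freeCiaMonadPointStrength : MonadPointStrength (freeCiaMonad T) where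
  app x y := freeCiaStrength sH T x y
  naturality := freeCiaStrength_naturality sH T
  unit := freeCiaStrength_unit sH T
  assoc := freeCiaStrength_assoc sH T
  preserves_unit := unit_freeCiaStrength sH T
  preserves_mul := freeCiaStrength_mul sH T

end

end PointStrengthOfFreeCia

theorem theorem3p7 {W : Type u} [Category.{v} W] [MonoidalCategory W] [MonoidallyLFP W]
    (H : W ⥤ W) [PreservesFilteredColimits H] (sH : PointStrength H)
    (T : ∀ X : W, FreeCia H X) :
    ∃ sT : MonadPointStrength (freeCiaMonad T),
      ∀ {X Y : W} (x : 𝟙_ W ⟶ X) (y : 𝟙_ W ⟶ Y),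
        (IsSolution (T (X ⊗ Y)).alg (strengthEquation sH T x y) (sT.app x y) ∧
          ∀ s, IsSolution (T (X ⊗ Y)).alg (strengthEquation sH T x y) s → s = sT.app x y) ∧
        (IsStrengthComponent sH T x y (sT.app x y) ∧
          ∀ s, IsStrengthComponent sH T x y s → s = sT.app x y) := by
  refine ⟨freeCiaMonadPointStrength sH T, fun x y => ?_⟩
  have h := isSolution_freeCiaStrength sH T x y
  have hu := eq_freeCiaStrength sH T x y
  refine ⟨⟨h, hu⟩, (isSolution_strengthEquation_iff sH T x y _).1 h, fun s hs => ?_⟩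
  exact hu s ((isSolution_strengthEquation_iff sH T x y s).2 hs)
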